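/- For a group $G$ generated by a finite set $S$, let $\ell_{G,S}(g)$ be the least length of a product of elements of $S\cup S^{-1}$ equal to $g\in G$, let $F_{G,S}(n)$ be the number of $g\in G$ with $\ell_{G,S}(g)\le n$, and let $$\omega(G,S)=\lim_{n\to\infty}F_{G,S}(n)^{1/n}$$ be the exponential growth rate of $G$ with respect to $S$. The minimal growth rate of $G$ is $\Omega(G)=\inf_S\omega(G,S)$, where $S$ runs over all finite generating sets of $G$. **Corollary 3.** Let $\mathbb Z\wr\mathbb Z=\bigl(\bigoplus_{\mathbb Z}\mathbb Z\bigr)\rtimes\mathbb Z$ be the restricted wreath product, let $t$ be the generator $1$ of the acting group $\mathbb Z$ (which acts by shifting coordinates), and let $a$ be the generator $1$ of the copy of $\mathbb Z$ at coordinate $0$. With respect to these elements, $$\mathbb Z\wr\mathbb Z=\langle a,t\mid [t^k a t^{-k},a]=1\ (k=1,2,\dots)\rangle .$$ For every finite generating set $S$ of $\mathbb Z\wr\mathbb Z$ the limit $\omega(\mathbb Z\wr\mathbb Z,S)$ exists, and the minimal growth rate is realized on the generating set $\{a,t\}$: $$\Omega(\mathbb Z\wr\mathbb Z)=\omega(\mathbb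 Z\wr\mathbb Z,\{a,t\})=1+\sqrt2 .$$ -/

import Mathlib

open Filter Topology
open scoped commutatorElement

noncomputable section

/-- The word length of `g` with respect to `S`: the least length of a product of elements of
`S ∪ S⁻¹` that is equal to `g`. -/
def wordLength {G : Type*} [Group G] (S : Set G) (g : G) : ℕ :=
  sInf {n : ℕ | ∃ l : List G, (∀ x ∈ l, x ∈ S ∨ x⁻¹ ∈ S) ∧ l.prod = g ∧ l.length = n}

/-- The growth function: the number of elements in the ball of radius `n` about the identity.
It is meant for finite sets `S` that generate `G`. -/
def growthFunction {G : Type*} [Group G] (S : Set G) (n : ℕ) : ℕ :=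
  Set.ncard {g : G | wordLength S g ≤ n}

/-- The exponential growth rate `ω(G, S)`, the limit of the `n`-th roots of the growth function. -/
def growthRate {G : Type*} [Group G] (S : Set G) : ℝ :=
  limUnder atTop (fun n : ℕ => (growthFunction S n : ℝ) ^ (1 / (n : ℝ)))

/-- The minimal growth rate `Ω(G)`: the infimum of `ω(G, S)` over all finite generating sets. -/
def minimalGrowthRate (G : Type*) [Group G] : ℝ :=
  sInf {r : ℝ | ∃ S : Set G, S.Finite ∧ Subgroup.closure S = ⊤ ∧ growthRate S = r}

/-- The restricted wreath product of `D` and `Q`: the elements of the (unrestricted) regular wreath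
product whose component `Q → D` has finite support. -/
def restrictedWreathProduct (D Q : Type*) [Group D] [Group Q] : Subgroup (D ≀ᵣ Q) where
  carrier := {x | (Function.mulSupport x.left).Finite}
  one_mem' := by simp
  mul_mem' := by
    intro x y hx hy
    refine (hx.union (hy.preimage (f := fun q : Q => x.right⁻¹ * q)
      (mul_right_injective _).injOn)).subset ?_
    exact Function.mulSupport_mul x.left (fun q => y.left (x.right⁻¹ * q))
  inv_mem' := by
    intro x hx
    refine (hx.preimage (f := fun q : Q => x.right * q) (mul_right_injective _).injOn).subset ?_
    intro q hq
    simpa using hq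

/-- The restricted wreath product `ℤ ≀ ℤ`. -/
abbrev ZWrZ : Type := restrictedWreathProduct (Multiplicative ℤ) (Multiplicative ℤ)

namespace ZWrZ

/-- The generator of the copy of the base group `ℤ` at the position `0`. -/
def a : ZWrZ :=
  ⟨⟨Pi.mulSingle 1 (Multiplicative.ofAdd 1), 1⟩,
    (Set.finite_singleton 1).subset Pi.mulSupport_mulSingle_subset⟩

/-- The generator of the acting group `ℤ`. -/
def t : ZWrZ :=
  ⟨⟨1, Multiplicative.ofAdd 1⟩, by simp [restrictedWreathProduct]⟩

/-- The relators `[t ^ k * a * t ^ (-k), a]`, `k = 1, 2, …`, where `a` and `t` are the free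
generators `0` and `1`. -/
def relators : Set (FreeGroup (Fin 2)) :=
  {r | ∃ k : ℕ, 1 ≤ k ∧
    r = ⁅FreeGroup.of (1 : Fin 2) ^ k * FreeGroup.of (0 : Fin 2) * (FreeGroup.of (1 : Fin 2) ^ k)⁻¹,
      FreeGroup.of (0 : Fin 2)⁆}

end ZWrZ

end

/-! Upper bound for `{a, t}`: an element of length at most `N` comes from a tour on the line that
stays in a window `[-p, q]`, ends at `n` and changes coordinates on the way. Only polynomially many
triples `(p, q, n)` occur, and for each of them the possible coordinates are counted by a generating
function at `z = √2 - 1`, where `(1 + z) / (1 - z) = 1 / z = 1 + √2` (`exists_mem_tourSet`,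
`ncard_tourSet_le`).

Lower bound: if `ω(G, S) < 1 + √2`, then `∑ z ^ ℓ(g)` converges for some `z > √2 - 1`, that is, `z²
+ 2z > 1`. This weight is a finite measure on the group which left multiplication by a letter
shrinks by at most the factor `z` (`cost_ofWeight`). The group acts on Laurent series over `ℚ` by
affine maps `y ↦ X ^ n * y + b`. Two noncommuting letters `u`, `v` can be normalized to `y + 1` and
`X ^ m * y`, or to `X ^ k * y` and `X ^ m * y + 1`. The measure is pushed forward along the orbit of
a fixed point of one of them. Short words in `u`, `v` send balls and shells into disjoint places,
and the resulting inequalities force `(z² + 2z - 1) * μ(ℚ⟦X⟧) ≤ 0`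
(`measure_eq_zero_of_translation`, `measure_eq_zero_of_dilations`). But the identity has positive
mass in `ℚ⟦X⟧`.

The presentation follows from the normal form `ψ F * y ^ n`. -/

section Growth

/-! ### Word length, growth functions and growth series. -/

variable {G : Type*} [Group G] {S : Set G}

lemma wordLength_prod_le {l : List G} (hl : ∀ x ∈ l, x ∈ S ∨ x⁻¹ ∈ S) :
    wordLength S l.prod ≤ l.length :=
  Nat.sInf_le ⟨l, hl, rfl, rfl⟩

/-- Generation makes the set in `wordLength` nonempty, so the infimum is attained and is not the
default `0`. -/
lemma exists_word (hS : Subgroup.closure S = ⊤) (g : G) :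
    ∃ l : List G, (∀ x ∈ l, x ∈ S ∨ x⁻¹ ∈ S) ∧ l.prod = g ∧ l.length = wordLength S g := by
  have : g ∈ (Subgroup.closure S).toSubmonoid := hS ▸ Subgroup.mem_top g
  rw [Subgroup.closure_toSubmonoid] at this
  obtain ⟨l, hl, hg⟩ := Submonoid.exists_list_of_mem_closure this
  exact Nat.sInf_mem
    (s := {n : ℕ | ∃ l : List G, (∀ x ∈ l, x ∈ S ∨ x⁻¹ ∈ S) ∧ l.prod = g ∧ l.length = n})
    ⟨l.length, l, hl, hg, rfl⟩

lemma wordLength_one : wordLength S (1 : G) = 0 :=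
  Nat.le_zero.1 (wordLength_prod_le (l := []) (by simp))

lemma wordLength_mul_le_add_one (hS : Subgroup.closure S = ⊤) {s : G} (hs : s ∈ S ∨ s⁻¹ ∈ S)
    (g : G) : wordLength S (s * g) ≤ wordLength S g + 1 := by
  obtain ⟨l, hl, rfl, h⟩ := exists_word hS g
  rw [← h, ← List.prod_cons, ← List.length_cons (a := s)]
  exact wordLength_prod_le (by simpa using ⟨hs, hl⟩)

lemma finite_ball (hf : S.Finite) (hS : Subgroup.closure S = ⊤) (n : ℕ) :
    {g : G | wordLength S g ≤ n}.Finite := by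
  have hT : {x : G | x ∈ S ∨ x⁻¹ ∈ S}.Finite := hf.union hf.inv
  suffices h : ∀ n : ℕ, {g : G | ∃ l : List G, (∀ x ∈ l, x ∈ S ∨ x⁻¹ ∈ S) ∧ l.prod = g ∧
      l.length ≤ n}.Finite by
    refine (h n).subset fun g hg => ?_
    obtain ⟨l, hl, hg', h⟩ := exists_word hS g
    exact ⟨l, hl, hg', h.trans_le hg⟩
  intro n
  induction n with
  | zero =>
    refine (Set.finite_singleton 1).subset ?_
    rintro g ⟨l, -, rfl, h⟩
    simp [List.length_eq_zero_iff.1 (Nat.le_zero.1 h)]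
  | succ n ih =>
    refine ((Set.finite_singleton 1).union (hT.mul ih)).subset ?_
    rintro g ⟨l, hl, rfl, h⟩
    cases l with
    | nil => simp
    | cons x l =>
      rw [List.forall_mem_cons] at hl
      refine Or.inr ⟨x, hl.1, l.prod, ⟨l, hl.2, rfl, ?_⟩, by simp⟩
      simpa using h

lemma growthFunction_pos (hf : S.Finite) (hS : Subgroup.closure S = ⊤) (n : ℕ) :
    0 < growthFunction S n :=
  (Set.ncard_pos (finite_ball hf hS n)).2 ⟨1, by simp [wordLength_one]⟩

/-- A word of length at most `m + n` is cut after its first `m` letters. -/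
lemma growthFunction_add_le (hf : S.Finite) (hS : Subgroup.closure S = ⊤) (m n : ℕ) :
    growthFunction S (m + n) ≤ growthFunction S m * growthFunction S n := by
  have h : {g : G | wordLength S g ≤ m + n} ⊆
      Set.image2 (· * ·) {g : G | wordLength S g ≤ m} {g : G | wordLength S g ≤ n} := by
    intro g hg
    obtain ⟨l, hl, rfl, h⟩ := exists_word hS g
    refine ⟨(l.take m).prod, ?_, (l.drop m).prod, ?_, List.prod_take_mul_prod_drop l m⟩
    · exact (wordLength_prod_le fun x hx => hl x (List.mem_of_mem_take hx)).trans
        (by simp)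
    · refine (wordLength_prod_le fun x hx => hl x (List.mem_of_mem_drop hx)).trans ?_
      have : wordLength S l.prod ≤ m + n := hg
      simp only [List.length_drop]
      lia
  have hm := finite_ball hf hS m
  have hn := finite_ball hf hS n
  refine (Set.ncard_le_ncard h (hm.image2 _ hn)).trans ?_
  rw [← Set.image_prod]
  refine (Set.ncard_image_le (hm.prod hn)).trans ?_
  rw [Set.ncard_prod]
  rfl

/-- The limit defining the growth rate exists. -/
theorem tendsto_growthRate (hf : S.Finite) (hS : Subgroup.closure S = ⊤) :
    Tendsto (fun n : ℕ => (growthFunction S n : ℝ) ^ (1 / (n : ℝ))) atTop (𝓝 (growthRate S)) := by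
  have hpos : ∀ n, (0 : ℝ) < growthFunction S n := fun n => by
    exact_mod_cast growthFunction_pos hf hS n
  have hsub : Subadditive fun n => Real.log (growthFunction S n) := fun m n => by
    rw [← Real.log_mul (hpos m).ne' (hpos n).ne']
    exact Real.log_le_log (hpos _) (by exact_mod_cast growthFunction_add_le hf hS m n)
  have hbdd : BddBelow (Set.range fun n : ℕ => Real.log (growthFunction S n) / n) := by
    refine ⟨0, ?_⟩
    rintro _ ⟨n, rfl⟩
    exact div_nonneg (Real.log_natCast_nonneg _) n.cast_nonneg
  refine tendsto_nhds_limUnder ⟨Real.exp hsub.lim, ?_⟩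
  refine ((Real.continuous_exp.tendsto _).comp (hsub.tendsto_lim hbdd)).congr fun n => ?_
  rw [Function.comp_apply, Real.rpow_def_of_pos (hpos n), mul_one_div]

/-- Below the radius of convergence the growth series converges absolutely, also as a sum over the
elements of the group. -/
theorem summable_pow_wordLength (hf : S.Finite) (hS : Subgroup.closure S = ⊤) {z : ℝ} (hz : 0 < z)
    (h : growthRate S < z⁻¹) : Summable fun g : G => z ^ wordLength S g := by
  obtain ⟨w, hw, hwz⟩ := exists_between h
  have hw0 : 0 ≤ w := (ge_of_tendsto' (tendsto_growthRate hf hS)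
    fun n => Real.rpow_nonneg (Nat.cast_nonneg _) _).trans hw.le
  have hle : ∀ᶠ n : ℕ in atTop, ‖(growthFunction S n : ℝ) * z ^ n‖ ≤ (w * z) ^ n := by
    filter_upwards [(tendsto_growthRate hf hS).eventually_lt_const hw, eventually_gt_atTop 0]
      with n hn hn0
    rw [Real.norm_of_nonneg (by positivity), mul_pow]
    refine mul_le_mul_of_nonneg_right ?_ (by positivity)
    have h1 := pow_le_pow_left₀ (Real.rpow_nonneg (Nat.cast_nonneg _) _) hn.le n
    rwa [one_div, Real.rpow_inv_natCast_pow (Nat.cast_nonneg _) hn0.ne'] at h1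
  have hsum : Summable fun n : ℕ => (growthFunction S n : ℝ) * z ^ n := by
    refine Summable.of_norm_bounded_eventually_nat (summable_geometric_of_lt_one (by positivity) ?_)
      hle
    rwa [← one_div, lt_div_iff₀ hz] at hwz
  refine summable_of_sum_le (c := ∑' n : ℕ, (growthFunction S n : ℝ) * z ^ n)
    (fun g => by positivity) fun s => ?_
  classical
  calc ∑ g ∈ s, z ^ wordLength S g
      = ∑ n ∈ s.image (wordLength S), ∑ g ∈ s with wordLength S g = n, z ^ wordLength S g :=
        (Finset.sum_fiberwise_of_maps_to (fun g hg => Finset.mem_image_of_mem _ hg) _).symm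
    _ ≤ ∑ n ∈ s.image (wordLength S), (growthFunction S n : ℝ) * z ^ n := by
        refine Finset.sum_le_sum fun n _ => ?_
        rw [Finset.sum_congr rfl (g := fun _ => z ^ n)
          fun g hg => by rw [(Finset.mem_filter.1 hg).2], Finset.sum_const, nsmul_eq_mul]
        refine mul_le_mul_of_nonneg_right ?_ (by positivity)
        rw [← Set.ncard_coe_finset]
        exact_mod_cast Set.ncard_le_ncard
          (fun g hg => le_of_eq (Finset.mem_filter.1 (Finset.mem_coe.1 hg)).2)
          (finite_ball hf hS n)
    _ ≤ _ := hsum.sum_le_tsum _ fun n _ => by positivity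

/-- A bound by a polynomial times an exponential bounds the growth rate. -/
theorem growthRate_le (hf : S.Finite) (hS : Subgroup.closure S = ⊤) {C w : ℝ}
    (hw : 0 < w) (d : ℕ) (h : ∀ n : ℕ, (growthFunction S n : ℝ) ≤ C * ((n : ℝ) + 1) ^ d * w ^ n) :
    growthRate S ≤ w := by
  by_contra! hlt
  obtain ⟨w', hw', hlt'⟩ := exists_between hlt
  have hw0 : 0 < w' := hw.trans hw'
  -- The extra factor `w / w'` turns the bound into a sequence in `n + 1`, which tends to `0`.
  have h1 : ∀ᶠ n : ℕ in atTop, w / w' ≤ C * (((n + 1 : ℕ) : ℝ) ^ d * (w / w') ^ (n + 1)) := by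
    filter_upwards [(tendsto_growthRate hf hS).eventually_const_lt hlt', eventually_gt_atTop 0]
      with n hn hn0
    have h2 := pow_le_pow_left₀ hw0.le hn.le n
    rw [one_div, Real.rpow_inv_natCast_pow (Nat.cast_nonneg _) hn0.ne'] at h2
    have h3 : 1 ≤ C * ((n : ℝ) + 1) ^ d * (w / w') ^ n := by
      rw [div_pow, ← mul_div_assoc, one_le_div (by positivity)]
      exact h2.trans (h n)
    calc w / w' ≤ w / w' * (C * ((n : ℝ) + 1) ^ d * (w / w') ^ n) :=
          le_mul_of_one_le_right (by positivity) h3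
      _ = _ := by push_cast; ring
  have h2 : Tendsto (fun n : ℕ => C * (((n + 1 : ℕ) : ℝ) ^ d * (w / w') ^ (n + 1))) atTop
      (𝓝 (C * 0)) := by
    refine Tendsto.const_mul C ((tendsto_pow_const_mul_const_pow_of_abs_lt_one d ?_).comp
      (tendsto_add_atTop_nat 1))
    rwa [abs_of_nonneg (by positivity), div_lt_one hw0]
  have h3 := ge_of_tendsto h2 h1
  rw [mul_zero] at h3
  exact absurd (div_pos hw hw0) h3.not_gt

end Growth

/-! ### Coordinates in `ℤ ≀ ℤ` and the presentation. -/

namespace ZWrZ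

/-- The coordinate of `g` at the position `i`. -/
def conf (g : ZWrZ) (i : ℤ) : ℤ := Multiplicative.toAdd (g.1.left (Multiplicative.ofAdd i))

/-- The image of `g` in the acting group `ℤ`. -/
def pos (g : ZWrZ) : ℤ := Multiplicative.toAdd g.1.right

lemma ext_conf {g h : ZWrZ} (h1 : ∀ i, conf g i = conf h i) (h2 : pos g = pos h) : g = h :=
  Subtype.ext (RegularWreathProduct.ext (funext fun q => h1 (Multiplicative.toAdd q)) h2)

@[simp] lemma conf_one (i : ℤ) : conf 1 i = 0 := rfl

@[simp] lemma pos_one : pos 1 = 0 := rfl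

lemma conf_mul (g h : ZWrZ) (i : ℤ) : conf (g * h) i = conf g i + conf h (i - pos g) := by
  rw [sub_eq_neg_add]
  rfl

@[simp] lemma pos_mul (g h : ZWrZ) : pos (g * h) = pos g + pos h := rfl

@[simp] lemma pos_inv (g : ZWrZ) : pos g⁻¹ = -pos g := rfl

lemma conf_inv (g : ZWrZ) (i : ℤ) : conf g⁻¹ i = -conf g (i + pos g) := by
  rw [add_comm]
  rfl

lemma conf_a (i : ℤ) : conf a i = if i = 0 then 1 else 0 := by
  simp only [conf, a, Pi.mulSingle_apply, ofAdd_eq_one]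
  split_ifs <;> rfl

@[simp] lemma pos_a : pos a = 0 := rfl

@[simp] lemma conf_t (i : ℤ) : conf t i = 0 := rfl

@[simp] lemma pos_t : pos t = 1 := rfl

lemma finite_support_conf (g : ZWrZ) : (Function.support (conf g)).Finite :=
  g.2.preimage (f := Multiplicative.ofAdd) Multiplicative.ofAdd.injective.injOn

/-- The inclusion of the base group. -/
def base : Multiplicative (ℤ →₀ ℤ) →* ZWrZ where
  toFun F := ⟨⟨fun q => Multiplicative.ofAdd (Multiplicative.toAdd F (Multiplicative.toAdd q)), 1⟩,
    (Multiplicative.toAdd F).hasFiniteSupport.preimage (f := Multiplicative.toAdd)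
      Multiplicative.toAdd.injective.injOn⟩
  map_one' := rfl
  map_mul' F F' := ext_conf (fun i => by
    rw [conf_mul]
    change _ = Multiplicative.toAdd F i + Multiplicative.toAdd F' (i - 0)
    rw [sub_zero]
    rfl) rfl

@[simp] lemma conf_base (F : ℤ →₀ ℤ) (i : ℤ) : conf (base (Multiplicative.ofAdd F)) i = F i := rfl

@[simp] lemma pos_base (F : Multiplicative (ℤ →₀ ℤ)) : pos (base F) = 0 := rfl

/-- The inclusion of the acting group. -/
def shift : Multiplicative ℤ →* ZWrZ where
  toFun n := ⟨⟨1, n⟩, by simp [restrictedWreathProduct]⟩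
  map_one' := rfl
  map_mul' m n := ext_conf (fun i => by rw [conf_mul]; rfl) rfl

lemma t_zpow (n : ℤ) : t ^ n = shift (Multiplicative.ofAdd n) := by
  rw [show t = shift (Multiplicative.ofAdd 1) from rfl, ← map_zpow, ← ofAdd_zsmul, smul_eq_mul,
    mul_one]

@[simp] lemma conf_t_zpow (n i : ℤ) : conf (t ^ n) i = 0 := by rw [t_zpow]; rfl

@[simp] lemma pos_t_zpow (n : ℤ) : pos (t ^ n) = n := by rw [t_zpow]; rfl

lemma base_single_one (i : ℤ) :
    base (Multiplicative.ofAdd (Finsupp.single i 1)) = t ^ i * a * (t ^ i)⁻¹ := by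
  refine ext_conf (fun j => ?_) (by simp)
  simp only [conf_base, conf_mul, conf_t_zpow, pos_t_zpow, conf_a, conf_inv, pos_mul, pos_a,
    Finsupp.single_apply]
  simp [eq_comm, sub_eq_zero]

lemma single_eq_zpow (i n : ℤ) : (Multiplicative.ofAdd (Finsupp.single i n : ℤ →₀ ℤ)) =
    Multiplicative.ofAdd (Finsupp.single i (1 : ℤ)) ^ n := by
  rw [← ofAdd_zsmul, Finsupp.smul_single, smul_eq_mul, mul_one]

lemma exists_eq_base_mul_zpow (g : ZWrZ) : ∃ F, g = base F * t ^ pos g :=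
  ⟨Multiplicative.ofAdd (Finsupp.ofSupportFinite (conf g) (finite_support_conf g)),
    ext_conf (fun i => by simp [conf_mul, Finsupp.ofSupportFinite_coe]) (by simp)⟩

theorem closure_a_t : Subgroup.closure ({a, t} : Set ZWrZ) = ⊤ := by
  have ha : a ∈ Subgroup.closure ({a, t} : Set ZWrZ) := Subgroup.subset_closure (by simp)
  have ht : t ∈ Subgroup.closure ({a, t} : Set ZWrZ) := Subgroup.subset_closure (by simp)
  have hb : ∀ F : ℤ →₀ ℤ,
      base (Multiplicative.ofAdd F) ∈ Subgroup.closure ({a, t} : Set ZWrZ) := by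
    intro F
    induction F using Finsupp.induction_linear with
    | zero => exact one_mem _
    | add F F' h h' => rw [ofAdd_add, map_mul]; exact mul_mem h h'
    | single i n =>
      rw [single_eq_zpow, map_zpow, base_single_one]
      exact zpow_mem (mul_mem (mul_mem (zpow_mem ht i) ha) (inv_mem (zpow_mem ht i))) n
  refine (Subgroup.eq_top_iff' _).2 fun g => ?_
  obtain ⟨F, hF⟩ := exists_eq_base_mul_zpow g
  rw [hF]
  exact mul_mem (hb (Multiplicative.toAdd F)) (zpow_mem ht _)

/-- A family of commuting elements defines a homomorphism from the free abelian group. -/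
lemma exists_hom_of_commute {G ι : Type*} [Group G] (A : ι → G)
    (hA : ∀ i j, Commute (A i) (A j)) : ∃ ψ : Multiplicative (ι →₀ ℤ) →* G,
      ∀ i, ψ (Multiplicative.ofAdd (Finsupp.single i 1)) = A i := by
  have hcomm : ∀ x ∈ Set.range A, ∀ y ∈ Set.range A, x * y = y * x := by
    rintro _ ⟨i, rfl⟩ _ ⟨j, rfl⟩
    exact hA i j
  have := Subgroup.isMulCommutative_closure hcomm
  let H := Subgroup.closure (Set.range A)
  let : CommGroup H := { mul_comm := fun x y => mul_comm' x y }
  let f : (ι →₀ ℤ) →+ Additive H := Finsupp.liftAddHom fun i =>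
    zmultiplesHom (Additive H) (Additive.ofMul ⟨A i, Subgroup.subset_closure ⟨i, rfl⟩⟩)
  refine ⟨H.subtype.comp (AddMonoidHom.toMultiplicativeLeft f), fun i => ?_⟩
  simp [f]

/-- The homomorphism from the presented group to `ℤ ≀ ℤ`. -/
def ofPresented : PresentedGroup relators →* ZWrZ :=
  PresentedGroup.toGroup (f := ![a, t]) <| by
    rintro _ ⟨k, -, rfl⟩
    have h0 : a = base (Multiplicative.ofAdd (Finsupp.single 0 1)) := by
      simp [base_single_one]
    have h1 : t ^ k * a * (t ^ k)⁻¹ = base (Multiplicative.ofAdd (Finsupp.single (k : ℤ) 1)) := by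
      simp [base_single_one]
    simp only [map_commutatorElement, map_mul, map_pow, map_inv, FreeGroup.lift_apply_of,
      Matrix.cons_val_zero, Matrix.cons_val_one]
    rw [h1, h0, ← map_commutatorElement, commutatorElement_eq_one_iff_mul_comm.2 (mul_comm _ _),
      map_one]

@[simp] lemma ofPresented_zero : ofPresented (PresentedGroup.of 0) = a :=
  PresentedGroup.toGroup.of _

@[simp] lemma ofPresented_one : ofPresented (PresentedGroup.of 1) = t :=
  PresentedGroup.toGroup.of _

/-- Conjugating a relator by a power of `y` reaches every pair `i`, `j`; only the difference `i - j`
matters. -/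
lemma commute_conj (i j : ℤ) :
    Commute ((PresentedGroup.of 1 : PresentedGroup relators) ^ i * PresentedGroup.of 0 *
        (PresentedGroup.of 1 ^ i)⁻¹)
      (PresentedGroup.of 1 ^ j * PresentedGroup.of 0 * (PresentedGroup.of 1 ^ j)⁻¹) := by
  set x : PresentedGroup relators := PresentedGroup.of 0
  set y : PresentedGroup relators := PresentedGroup.of 1
  have hnat : ∀ k : ℕ, Commute (y ^ k * x * (y ^ k)⁻¹) x := by
    intro k
    rcases k.eq_zero_or_pos with rfl | hk
    · simp
    · have := PresentedGroup.one_of_mem (rels := relators) ⟨k, hk, rfl⟩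
      simp only [map_commutatorElement, map_mul, map_pow, map_inv] at this
      exact commutatorElement_eq_one_iff_mul_comm.1 this
  wlog h : j ≤ i generalizing i j
  · exact (this j i (by lia)).symm
  obtain ⟨k, rfl⟩ := Int.exists_add_of_le h
  have : Commute (y ^ j * (y ^ k * x * (y ^ k)⁻¹) * (y ^ j)⁻¹) (y ^ j * x * (y ^ j)⁻¹) :=
    (hnat k).map (MulAut.conj (y ^ j)).toMonoidHom
  simpa [zpow_add, mul_assoc] using this

/-- By `hconj`, powers of `y` move past the image of `ψ`, so every element has the form `ψ F * y ^
n`; its image in `ℤ ≀ ℤ` determines `F` and `n`. -/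
theorem bijective_ofPresented : Function.Bijective ofPresented := by
  set x : PresentedGroup relators := PresentedGroup.of 0 with hx
  set y : PresentedGroup relators := PresentedGroup.of 1 with hy
  obtain ⟨ψ, hψ⟩ := exists_hom_of_commute (fun i : ℤ => y ^ i * x * (y ^ i)⁻¹) commute_conj
  have hbase : ∀ F : ℤ →₀ ℤ, ofPresented (ψ (Multiplicative.ofAdd F)) =
      base (Multiplicative.ofAdd F) := by
    intro F
    induction F using Finsupp.induction_linear with
    | zero => simp
    | add F F' h h' => rw [ofAdd_add, map_mul, map_mul, map_mul, h, h']
    | single i n =>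
      rw [single_eq_zpow, map_zpow, map_zpow, map_zpow, hψ, base_single_one]
      simp [hx, hy]
  have hconj : ∀ (j : ℤ) (F : ℤ →₀ ℤ), ∃ F', y ^ j * ψ (Multiplicative.ofAdd F) = ψ F' * y ^ j := by
    intro j F
    induction F using Finsupp.induction_linear with
    | zero => exact ⟨1, by simp⟩
    | add F F' h h' =>
      obtain ⟨E, hE⟩ := h
      obtain ⟨E', hE'⟩ := h'
      refine ⟨E * E', ?_⟩
      rw [ofAdd_add, map_mul, ← mul_assoc, hE, mul_assoc, hE', ← mul_assoc, map_mul]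
    | single i n =>
      refine ⟨Multiplicative.ofAdd (Finsupp.single (j + i) n), ?_⟩
      have h : y ^ (j + i) * x * (y ^ (j + i))⁻¹ =
          y ^ j * (y ^ i * x * (y ^ i)⁻¹) * (y ^ j)⁻¹ := by simp [zpow_add, mul_assoc]
      rw [single_eq_zpow, map_zpow, hψ, single_eq_zpow, map_zpow, hψ, h, conj_zpow (a := y ^ j),
        inv_mul_cancel_right]
  have hform : ∀ p : PresentedGroup relators, ∃ F n, p = ψ F * y ^ (n : ℤ) := by
    intro p
    have hp : p ∈ Subgroup.closure (Set.range (PresentedGroup.of (rels := relators))) := by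
      rw [PresentedGroup.closure_range_of]
      trivial
    have hstep : ∀ (E : Multiplicative (ℤ →₀ ℤ)) (j : ℤ) (p : PresentedGroup relators),
        (∃ F n, p = ψ F * y ^ (n : ℤ)) → ∃ F n, ψ E * y ^ j * p = ψ F * y ^ (n : ℤ) := by
      rintro E j _ ⟨F, n, rfl⟩
      obtain ⟨F', hF'⟩ := hconj j (Multiplicative.toAdd F)
      rw [ofAdd_toAdd] at hF'
      refine ⟨E * F', j + n, ?_⟩
      rw [mul_assoc, ← mul_assoc (y ^ j), hF', zpow_add, map_mul]
      group
    have hx' : ∀ n : ℤ, x ^ n = ψ (Multiplicative.ofAdd (Finsupp.single 0 n)) * y ^ (0 : ℤ) := by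
      intro n
      rw [single_eq_zpow, map_zpow, hψ]
      simp
    induction hp using Subgroup.closure_induction_left with
    | one => exact ⟨1, 0, by simp⟩
    | mul_left g hg p hp ih =>
      obtain ⟨i, rfl⟩ := hg
      fin_cases i
      · have := hstep (Multiplicative.ofAdd (Finsupp.single 0 1)) 0 p ih
        rwa [← hx' 1, zpow_one] at this
      · simpa using hstep 1 1 p ih
    | inv_mul_cancel g hg p hp ih =>
      obtain ⟨i, rfl⟩ := hg
      fin_cases i
      · have := hstep (Multiplicative.ofAdd (Finsupp.single 0 (-1))) 0 p ih
        rwa [← hx' (-1), zpow_neg_one] at this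
      · simpa using hstep 1 (-1) p ih
  constructor
  · rw [injective_iff_map_eq_one]
    intro p hp
    obtain ⟨F, n, rfl⟩ := hform p
    have hF := hbase (Multiplicative.toAdd F)
    rw [ofAdd_toAdd] at hF
    rw [map_mul, map_zpow, hF, hy, ofPresented_one] at hp
    have hn : n = 0 := by simpa using congrArg pos hp
    subst hn
    have hF0 : Multiplicative.toAdd F = 0 := by
      ext i
      have h : conf (base F) i = 0 := by simpa using congrArg (fun g => conf g i) hp
      exact h
    rw [toAdd_eq_zero.1 hF0]
    simp
  · rw [← MonoidHom.range_eq_top, eq_top_iff, ← closure_a_t, Subgroup.closure_le]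
    rintro _ (rfl | rfl)
    · exact ⟨_, ofPresented_zero⟩
    · exact ⟨_, ofPresented_one⟩

end ZWrZ

/-! ### The upper bound for the generating set `{a, t}`. -/

lemma sum_Icc_pow_natAbs_le {z : ℝ} (hz : 0 ≤ z) (hz1 : z < 1) (M : ℕ) :
    ∑ j ∈ Finset.Icc (-(M : ℤ)) M, z ^ j.natAbs ≤ (1 + z) / (1 - z) := by
  suffices h : (1 - z) * ∑ j ∈ Finset.Icc (-(M : ℤ)) M, z ^ j.natAbs = 1 + z - 2 * z ^ (M + 1) by
    rw [le_div_iff₀' (by linarith), h]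
    linarith [pow_nonneg hz (M + 1)]
  induction M with
  | zero => simp; ring
  | succ M ih =>
    have e : Finset.Icc (-((M + 1 : ℕ) : ℤ)) (M + 1 : ℕ) =
        insert (-((M + 1 : ℕ) : ℤ)) (insert ((M + 1 : ℕ) : ℤ) (Finset.Icc (-(M : ℤ)) M)) := by
      ext i
      simp only [Finset.mem_Icc, Finset.mem_insert]
      lia
    rw [e, Finset.sum_insert (by simp only [Finset.mem_insert, Finset.mem_Icc]; lia),
      Finset.sum_insert (by simp), mul_add, mul_add, ih, Int.natAbs_neg, Int.natAbs_natCast]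
    ring

/-- The number of integer points in a ball of the `ℓ¹` norm, bounded by generating functions. -/
lemma ncard_sum_natAbs_le {ι : Type*} [Fintype ι] {z : ℝ} (hz : 0 < z) (hz1 : z < 1) (M : ℕ) :
    {f : ι → ℤ | ∑ i, (f i).natAbs ≤ M}.Finite ∧
    ({f : ι → ℤ | ∑ i, (f i).natAbs ≤ M}.ncard : ℝ) * z ^ M ≤
      ((1 + z) / (1 - z)) ^ Fintype.card ι := by
  classical
  set s : Finset (ι → ℤ) := Fintype.piFinset fun _ => Finset.Icc (-(M : ℤ)) M with hs
  have hsub : {f : ι → ℤ | ∑ i, (f i).natAbs ≤ M} =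
      ((s.filter fun f => ∑ i, (f i).natAbs ≤ M : Finset (ι → ℤ)) : Set (ι → ℤ)) := by
    ext f
    simp only [Set.mem_ofPred_eq, Finset.coe_filter, hs, Fintype.mem_piFinset, Finset.mem_Icc,
      iff_and_self]
    intro h i
    have := Finset.single_le_sum (f := fun i => (f i).natAbs) (fun _ _ => Nat.zero_le _)
      (Finset.mem_univ i)
    lia
  rw [hsub]
  refine ⟨Finset.finite_toSet _, ?_⟩
  rw [Set.ncard_coe_finset, ← nsmul_eq_mul, ← Finset.sum_const]
  -- Every counted point has weight at least `z ^ M`, and the total weight over the box is a product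
  -- of one-dimensional sums.
  calc ∑ f ∈ s with ∑ i, (f i).natAbs ≤ M, z ^ M
      ≤ ∑ f ∈ s with ∑ i, (f i).natAbs ≤ M, ∏ i, z ^ (f i).natAbs := by
        refine Finset.sum_le_sum fun f hf => ?_
        rw [Finset.prod_pow_eq_pow_sum]
        exact pow_le_pow_of_le_one hz.le hz1.le (Finset.mem_filter.1 hf).2
    _ ≤ ∑ f ∈ s, ∏ i, z ^ (f i).natAbs :=
        Finset.sum_le_sum_of_subset_of_nonneg (Finset.filter_subset _ _)
          fun f _ _ => Finset.prod_nonneg fun i _ => by positivity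
    _ = ∏ _i : ι, ∑ j ∈ Finset.Icc (-(M : ℤ)) M, z ^ j.natAbs := by
        rw [Finset.prod_univ_sum]
    _ ≤ ∏ _i : ι, (1 + z) / (1 - z) :=
        Finset.prod_le_prod (fun i _ => Finset.sum_nonneg fun _ _ => by positivity)
          fun i _ => sum_Icc_pow_natAbs_le hz.le hz1 M
    _ = _ := by rw [Finset.prod_const, Finset.card_univ]

namespace ZWrZ

/-- The elements whose coordinates vanish outside `[-p, q]`, that project to `n ∈ [-p, q]`, and for
which the sum of the absolute values of the coordinates and the length `2 * p + 2 * q - |n|` of the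
shortest tour from `0` to `n` through `-p` and `q` is at most `N`. -/
def tourSet (N : ℕ) (x : ℕ × ℕ × ℤ) : Set ZWrZ :=
  {g | (∀ i, i < -(x.1 : ℤ) ∨ (x.2.1 : ℤ) < i → conf g i = 0) ∧ pos g = x.2.2 ∧
    -(x.1 : ℤ) ≤ x.2.2 ∧ x.2.2 ≤ x.2.1 ∧
    ∑ i ∈ Finset.Icc (-(x.1 : ℤ)) x.2.1, (conf g i).natAbs + 2 * x.1 + 2 * x.2.1 ≤
      N + x.2.2.natAbs}

/-- Appending `a` or its inverse alters the coordinate at the current position, while `t` or its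
inverse moves the position. A move out of the window adds `2` to `2 * p + 2 * q`, paid for by one
more letter and by the growth of `|n|`. -/
lemma exists_mem_tourSet {l : List ZWrZ}
    (hl : ∀ x ∈ l, x ∈ ({a, t} : Set ZWrZ) ∨ x⁻¹ ∈ ({a, t} : Set ZWrZ)) :
    ∃ x, l.prod ∈ tourSet l.length x := by
  induction l using List.reverseRecOn with
  | nil => exact ⟨(0, 0, 0), by simp [tourSet]⟩
  | append_singleton l s ih =>
    obtain ⟨⟨p, q, n⟩, h0, hn, hp, hq, hsum⟩ := ih fun x hx => hl x (by simp [hx])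
    have hs := hl s (by simp)
    simp only at h0 hn hp hq hsum
    rw [List.prod_append, List.prod_singleton, List.length_append, List.length_singleton]
    generalize l.prod = g at *
    -- the steps within the base group
    have hbase : ∀ e : ℤ, e.natAbs = 1 → (∀ i, conf s i = if i = 0 then e else 0) → pos s = 0 →
        ∃ x, g * s ∈ tourSet (l.length + 1) x := by
      intro e he hsc hsp
      have hc : ∀ i, conf (g * s) i = conf g i + if i = n then e else 0 := fun i => by
        rw [conf_mul, hsc, hn]
        simp only [sub_eq_zero]
      refine ⟨(p, q, n), fun i hi => ?_, by simp [hn, hsp], hp, hq, ?_⟩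
      · simp only at hi
        rw [hc, h0 i hi, if_neg (by lia), add_zero]
      · have : ∑ i ∈ Finset.Icc (-(p : ℤ)) q, (conf (g * s) i).natAbs ≤
            ∑ i ∈ Finset.Icc (-(p : ℤ)) q, ((conf g i).natAbs + if i = n then 1 else 0) := by
          refine Finset.sum_le_sum fun i _ => ?_
          rw [hc]
          split_ifs <;> lia
        rw [Finset.sum_add_distrib, Finset.sum_ite_eq', if_pos (Finset.mem_Icc.2 ⟨hp, hq⟩)] at this
        simp only
        lia
    -- the steps along the acting group
    have hshift : ∀ e : ℤ, e.natAbs = 1 → (∀ i, conf s i = 0) → pos s = e →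
        ∃ x, g * s ∈ tourSet (l.length + 1) x := by
      intro e he hsc hsp
      have hc : ∀ i, conf (g * s) i = conf g i := fun i => by rw [conf_mul, hsc, add_zero]
      have hext : ∀ p' q' : ℕ, p ≤ p' → q ≤ q' →
          ∑ i ∈ Finset.Icc (-(p' : ℤ)) q', (conf g i).natAbs =
            ∑ i ∈ Finset.Icc (-(p : ℤ)) q, (conf g i).natAbs := fun p' q' hp' hq' => by
        refine (Finset.sum_subset (Finset.Icc_subset_Icc (by lia) (by lia)) fun i _ hi => ?_).symm
        rw [h0 i (by rw [Finset.mem_Icc] at hi; lia), Int.natAbs_zero]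
      have hmem : ∀ p' q' : ℕ, p ≤ p' → q ≤ q' → -(p' : ℤ) ≤ n + e → n + e ≤ q' →
          2 * p' + 2 * q' + n.natAbs ≤ 2 * p + 2 * q + 1 + (n + e).natAbs →
          ∃ x, g * s ∈ tourSet (l.length + 1) x := fun p' q' hp' hq' h1 h2 h3 => by
        refine ⟨(p', q', n + e), fun i hi => ?_, by simp [hn, hsp], h1, h2, ?_⟩
        · simp only at hi
          rw [hc, h0 i (by lia)]
        · simp only [hc, hext p' q' hp' hq']
          lia
      by_cases h1 : n + e < -p
      · exact hmem (p + 1) q (by lia) le_rfl (by lia) (by lia) (by lia)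
      by_cases h2 : (q : ℤ) < n + e
      · exact hmem p (q + 1) le_rfl (by lia) (by lia) (by lia) (by lia)
      · exact hmem p q le_rfl le_rfl (by lia) (by lia) (by lia)
    rcases hs with (rfl | rfl) | (hs | hs)
    · exact hbase 1 rfl conf_a rfl
    · exact hshift 1 rfl conf_t rfl
    · rw [inv_eq_iff_eq_inv] at hs
      subst hs
      exact hbase (-1) rfl (fun i => by rw [conf_inv, conf_a]; simp; split_ifs <;> rfl) rfl
    · rw [Set.mem_singleton_iff, inv_eq_iff_eq_inv] at hs
      subst hs
      exact hshift (-1) rfl (fun i => by rw [conf_inv]; simp) rfl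

lemma sqrt_two_bounds : 1 < √2 ∧ √2 < 3 / 2 ∧ √2 * √2 = 2 := by
  refine ⟨?_, ?_, by norm_num⟩
  · rw [Real.lt_sqrt] <;> norm_num
  · rw [Real.sqrt_lt'] <;> norm_num

/-- The `p + q + 1` sites contribute `(1 + √2) ^ (p + q + 1)`, and the bound `M = N + |n| - 2p - 2q`
on the sum contributes `(1 + √2) ^ M`. The exponents add up to at most `N + 1` because `|n| ≤ p +
q`. -/
lemma ncard_tourSet_le (N : ℕ) (x : ℕ × ℕ × ℤ) :
    (tourSet N x).Finite ∧ ((tourSet N x).ncard : ℝ) ≤ (1 + √2) ^ (N + 1) := by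
  obtain ⟨p, q, n⟩ := x
  obtain ⟨b1, b2, b3⟩ := sqrt_two_bounds
  set T := tourSet N (p, q, n) with hT
  rcases T.eq_empty_or_nonempty with h | ⟨g₀, -, -, hp, hq, hN⟩
  · rw [h]
    simp only [Set.finite_empty, Set.ncard_empty, Nat.cast_zero, true_and]
    positivity
  simp only at hp hq hN
  obtain ⟨M, hM⟩ := Nat.exists_eq_add_of_le
    (show 2 * p + 2 * q ≤ N + n.natAbs by lia)
  let ι := Finset.Icc (-(p : ℤ)) q
  obtain ⟨hfin, hcard⟩ := ncard_sum_natAbs_le (ι := ι) (z := √2 - 1) (by linarith) (by linarith) M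
  have hκ : (1 + (√2 - 1)) / (1 - (√2 - 1)) = 1 + √2 := by
    rw [div_eq_iff (by linarith)]
    linarith
  have hι : Fintype.card ι = p + q + 1 := by
    rw [Fintype.card_coe, Int.card_Icc]
    lia
  let r : ZWrZ → ι → ℤ := fun g i => conf g i
  have hmaps : Set.MapsTo r T {f : ι → ℤ | ∑ i, (f i).natAbs ≤ M} := by
    rintro g ⟨-, -, -, -, h⟩
    have h' : ∑ i ∈ Finset.Icc (-(p : ℤ)) q, (conf g i).natAbs ≤ M := by
      simp only at h
      lia
    rwa [← Finset.sum_coe_sort] at h'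
  have hinj : Set.InjOn r T := by
    rintro g ⟨h1, h2, -⟩ g' ⟨h1', h2', -⟩ h
    refine ext_conf (fun i => ?_) (h2.trans h2'.symm)
    by_cases hi : i ∈ Finset.Icc (-(p : ℤ)) q
    · exact congrFun h ⟨i, hi⟩
    · rw [Finset.mem_Icc] at hi
      rw [h1 i (by simp only; lia), h1' i (by simp only; lia)]
  refine ⟨Set.Finite.of_finite_image (hfin.subset hmaps.image_subset) hinj, ?_⟩
  rw [hκ, hι] at hcard
  have hle : (T.ncard : ℝ) ≤ {f : ι → ℤ | ∑ i, (f i).natAbs ≤ M}.ncard := by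
    exact_mod_cast Set.ncard_le_ncard_of_injOn r hmaps hinj hfin
  have hw : (1 + √2) ^ M * (√2 - 1) ^ M = 1 := by
    rw [← mul_pow, show (1 + √2) * (√2 - 1) = 1 by linarith, one_pow]
  calc (T.ncard : ℝ) ≤ {f : ι → ℤ | ∑ i, (f i).natAbs ≤ M}.ncard := hle
    _ = ({f : ι → ℤ | ∑ i, (f i).natAbs ≤ M}.ncard * (√2 - 1) ^ M) * (1 + √2) ^ M := by
        rw [mul_assoc, mul_comm ((√2 - 1) ^ M), hw, mul_one]
    _ ≤ (1 + √2) ^ (p + q + 1) * (1 + √2) ^ M :=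
        mul_le_mul_of_nonneg_right hcard (by positivity)
    _ = (1 + √2) ^ (p + q + 1 + M) := (pow_add _ _ _).symm
    _ ≤ (1 + √2) ^ (N + 1) := pow_le_pow_right₀ (by linarith) (by lia)

theorem growthRate_a_t_le : growthRate ({a, t} : Set ZWrZ) ≤ 1 + √2 := by
  refine growthRate_le (by simp) closure_a_t (C := 2 * (1 + √2)) (by positivity) 3 fun N => ?_
  set I : Finset (ℕ × ℕ × ℤ) :=
    Finset.range (N + 1) ×ˢ Finset.range (N + 1) ×ˢ Finset.Icc (-(N : ℤ)) N
  have hsub : {g : ZWrZ | wordLength {a, t} g ≤ N} ⊆ ⋃ x ∈ I, tourSet N x := by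
    intro g hg
    obtain ⟨l, hl, rfl, hlen⟩ := exists_word closure_a_t g
    obtain ⟨⟨p, q, n⟩, h1, h2, h3, h4, h5⟩ := exists_mem_tourSet hl
    rw [Set.mem_ofPred_eq, ← hlen] at hg
    simp only at h3 h4 h5
    simp only [Set.mem_iUnion]
    refine ⟨(p, q, n), ?_, h1, h2, h3, h4, ?_⟩
    · simp only [I, Finset.mem_product, Finset.mem_range, Finset.mem_Icc]
      lia
    · simp only
      lia
  have h1 : growthFunction {a, t} N ≤ ∑ x ∈ I, (tourSet N x).ncard :=
    (Set.ncard_le_ncard hsub (I.finite_toSet.biUnion fun x _ => (ncard_tourSet_le N x).1)).trans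
      (Finset.set_ncard_biUnion_le _ _)
  have hI : (I.card : ℝ) ≤ 2 * ((N : ℝ) + 1) ^ 3 := by
    have : I.card = (N + 1) * ((N + 1) * (2 * N + 1)) := by
      simp only [I, Finset.card_product, Finset.card_range, Int.card_Icc]
      congr 2
      lia
    rw [this]
    push_cast
    nlinarith [sq_nonneg ((N : ℝ) + 1)]
  calc (growthFunction {a, t} N : ℝ) ≤ ∑ x ∈ I, ((tourSet N x).ncard : ℝ) := by exact_mod_cast h1
    _ ≤ ∑ _x ∈ I, (1 + √2) ^ (N + 1) := Finset.sum_le_sum fun x _ => (ncard_tourSet_le N x).2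
    _ = I.card * (1 + √2) ^ (N + 1) := by rw [Finset.sum_const, nsmul_eq_mul]
    _ ≤ 2 * ((N : ℝ) + 1) ^ 3 * (1 + √2) ^ (N + 1) :=
        mul_le_mul_of_nonneg_right hI (by positivity)
    _ = _ := by ring

end ZWrZ

/-! ### Finitely additive measures. -/

/-- A finite, finitely additive measure on all subsets of a type. -/
structure FinAddMeasure (α : Type*) where
  /-- The measure of a set. -/
  toFun : Set α → ℝ
  nonneg' : ∀ s, 0 ≤ toFun s
  union' : ∀ s t, Disjoint s t → toFun (s ∪ t) = toFun s + toFun t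

namespace FinAddMeasure

variable {α : Type*}

instance : CoeFun (FinAddMeasure α) fun _ => Set α → ℝ := ⟨toFun⟩

lemma nonneg (μ : FinAddMeasure α) (s : Set α) : 0 ≤ μ s := μ.nonneg' s

lemma add_le (μ : FinAddMeasure α) {s t w : Set α} (h : Disjoint s t) (hs : s ⊆ w) (ht : t ⊆ w) :
    μ s + μ t ≤ μ w := by
  have h1 := μ.union' (s ∪ t) (w \ (s ∪ t)) Set.disjoint_sdiff_right
  rw [Set.union_sdiff_cancel (Set.union_subset hs ht), μ.union' s t h] at h1
  linarith [μ.nonneg (w \ (s ∪ t))]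

lemma mono (μ : FinAddMeasure α) {s t : Set α} (h : s ⊆ t) : μ s ≤ μ t := by
  have h1 := μ.union' s (t \ s) Set.disjoint_sdiff_right
  rw [Set.union_sdiff_cancel h] at h1
  linarith [μ.nonneg (t \ s)]

lemma diff (μ : FinAddMeasure α) {s t : Set α} (h : s ⊆ t) : μ (t \ s) = μ t - μ s := by
  have h1 := μ.union' s (t \ s) Set.disjoint_sdiff_right
  rw [Set.union_sdiff_cancel h] at h1
  linarith

end FinAddMeasure

/-! ### Affine maps of Laurent series and almost invariant measures. -/

namespace LaurentSeries

/-- The monomial `X ^ n` as a Laurent series. -/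
noncomputable def mono (n : ℤ) : LaurentSeries ℚ := HahnSeries.single n 1

lemma coeff_mono_mul (n i : ℤ) (y : LaurentSeries ℚ) : (mono n * y).coeff i = y.coeff (i - n) := by
  rw [mono, HahnSeries.coeff_single_mul, one_mul]

lemma coeff_mono (n i : ℤ) : (mono n).coeff i = if i = n then 1 else 0 := by
  rw [mono, HahnSeries.coeff_single]
  congr

lemma mono_mul_mono (i j : ℤ) : mono i * mono j = mono (i + j) := by
  simp [mono]

lemma mono_zero : mono 0 = 1 := rfl

lemma coeff_one (i : ℤ) : (1 : LaurentSeries ℚ).coeff i = if i = 0 then 1 else 0 :=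
  coeff_mono 0 i

/-- The set of the Laurent series that agree with `c` in degrees less than `n`. -/
def cball (c : LaurentSeries ℚ) (n : ℤ) : Set (LaurentSeries ℚ) :=
  {y | ∀ i < n, y.coeff i = c.coeff i}

lemma cball_anti (c : LaurentSeries ℚ) {i j : ℤ} (h : i ≤ j) : cball c j ⊆ cball c i :=
  fun _ hy l hl => hy l (hl.trans_le h)

lemma cball_congr {c c' : LaurentSeries ℚ} {n : ℤ} (h : c ∈ cball c' n) :
    cball c n = cball c' n := by
  ext y
  exact forall₂_congr fun i hi => by rw [h i hi]

lemma affine_mem_cball (n i : ℤ) (b c y : LaurentSeries ℚ) :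
    mono n * y + b ∈ cball (mono n * c + b) (i + n) ↔ y ∈ cball c i := by
  constructor
  · intro h j hj
    have := h (j + n) (by lia)
    simpa [coeff_mono_mul] using this
  · intro h j hj
    have := h (j - n) (by lia)
    simpa [coeff_mono_mul] using this

lemma cball_one_zero : cball 1 0 = cball 0 0 :=
  cball_congr fun i hi => by simp [hi.ne]

/-- The affine map `y ↦ X ^ n * y + b` shrinks the measure of every set by at most the factor
`z ^ j`. -/
def Cost (μ : FinAddMeasure (LaurentSeries ℚ)) (z : ℝ) (n : ℤ) (b : LaurentSeries ℚ) (j : ℕ) :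
    Prop :=
  ∀ s, z ^ j * μ s ≤ μ ((fun y => mono n * y + b) '' s)

variable {μ : FinAddMeasure (LaurentSeries ℚ)} {z : ℝ}

namespace Cost

lemma comp {n n' : ℤ} {b b' : LaurentSeries ℚ} {j j' : ℕ} (hz : 0 ≤ z) (h : Cost μ z n b j)
    (h' : Cost μ z n' b' j') : Cost μ z (n + n') (mono n * b' + b) (j + j') := by
  intro s
  have e : (fun y => mono (n + n') * y + (mono n * b' + b)) '' s =
      (fun y => mono n * y + b) '' ((fun y => mono n' * y + b') '' s) := by
    rw [Set.image_image]
    congr 1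
    ext1 y
    rw [← mono_mul_mono]
    ring
  rw [e, pow_add, mul_assoc]
  exact (mul_le_mul_of_nonneg_left (h' s) (by positivity)).trans (h _)

lemma cball_le {n i : ℤ} {b c c' : LaurentSeries ℚ} {j : ℕ} (h : Cost μ z n b j)
    (hc : mono n * c + b = c') : z ^ j * μ (cball c i) ≤ μ (cball c' (i + n)) := by
  refine (h _).trans (μ.mono ?_)
  rintro _ ⟨y, hy, rfl⟩
  rw [← hc]
  exact (affine_mem_cball n i b c y).2 hy

lemma cball_diff_le {n i l : ℤ} {b c c' : LaurentSeries ℚ} {j : ℕ} (h : Cost μ z n b j)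
    (hc : mono n * c + b = c') (hil : i ≤ l) :
    z ^ j * (μ (cball c i) - μ (cball c l)) ≤ μ (cball c' (i + n)) - μ (cball c' (l + n)) := by
  rw [← μ.diff (cball_anti c hil), ← μ.diff (cball_anti c' (by lia))]
  refine (h _).trans (μ.mono ?_)
  rintro _ ⟨y, ⟨hy, hy'⟩, rfl⟩
  rw [← hc]
  exact ⟨(affine_mem_cball n i b c y).2 hy, fun h => hy' ((affine_mem_cball n l b c y).1 h)⟩

end Cost

/-- If a translation by a series with leading term `1` and the inverse translation shrink the
measure of every set by at most the factor `c`, then the translates of `1 + X ^ r * ℚ⟦X⟧` to one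
side and of `X ^ s * ℚ⟦X⟧` to the other side bound the measure of `ℚ⟦X⟧` from below. -/
lemma cball_add_cball_le {r s : ℤ} (hr : 0 < r) (hs : 0 < s) {θ : LaurentSeries ℚ}
    (hθr : θ ∈ cball 1 r) (hθs : θ ∈ cball 1 s) {j : ℕ}
    (h : Cost μ z 0 θ j) (h' : Cost μ z 0 (-θ) j) (hz : 0 ≤ z) (hz1 : z ≤ 1) :
    μ (cball 1 r) + μ (cball 0 s) ≤ (1 - z ^ j) * μ (cball 0 0) := by
  set P : Set (LaurentSeries ℚ) := {y | ∃ n : ℕ, 1 ≤ n ∧ y ∈ cball (HahnSeries.C (n : ℚ)) r}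
  set N : Set (LaurentSeries ℚ) := {y | ∃ n : ℕ, 1 ≤ n ∧ y ∈ cball (-HahnSeries.C (n : ℚ)) s}
  have hcC : ∀ (q : ℚ) (i : ℤ), (HahnSeries.C q : LaurentSeries ℚ).coeff i
      = if i = 0 then q else 0 := fun q i => by
    rw [HahnSeries.C_apply, HahnSeries.coeff_single]
    congr
  have hP0 : ∀ y ∈ P, 1 ≤ y.coeff 0 := by
    rintro y ⟨n, hn, hy⟩
    rw [hy 0 hr, hcC, if_pos rfl]
    exact_mod_cast hn
  have hN0 : ∀ y ∈ N, y.coeff 0 ≤ -1 := by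
    rintro y ⟨n, hn, hy⟩
    rw [hy 0 hs, HahnSeries.coeff_neg, hcC, if_pos rfl]
    have : (1 : ℚ) ≤ n := by exact_mod_cast hn
    linarith
  have hD0 : ∀ y ∈ cball (0 : LaurentSeries ℚ) s, y.coeff 0 = 0 := fun y hy => by
    simpa using hy 0 hs
  have hF0 : ∀ y ∈ cball (1 : LaurentSeries ℚ) r, y.coeff 0 = 1 := fun y hy => by
    simpa [coeff_one] using hy 0 hr
  have hPB : P ⊆ cball 0 0 := by
    rintro y ⟨n, hn, hy⟩ i hi
    rw [hy i (hi.trans hr), hcC, if_neg hi.ne, HahnSeries.coeff_zero]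
  have hNB : N ⊆ cball 0 0 := by
    rintro y ⟨n, hn, hy⟩ i hi
    rw [hy i (hi.trans hs), HahnSeries.coeff_neg, hcC, if_neg hi.ne, HahnSeries.coeff_zero, neg_zero]
  have hFP : cball 1 r ⊆ P := fun y hy => ⟨1, le_rfl, by simpa using hy⟩
  -- Translation by `θ` maps `P` into the part of `P` with constant coefficient at least `2`, which
  -- misses `1 + X ^ r * ℚ⟦X⟧`.
  have hP : μ (cball 1 r) + z ^ j * μ P ≤ μ P := by
    have hT : ∀ y ∈ (fun y => mono 0 * y + θ) '' P, 2 ≤ y.coeff 0 ∧ y ∈ P := by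
      rintro _ ⟨y, hy, rfl⟩
      have h1 := hP0 y hy
      refine ⟨?_, ?_⟩
      · simp only [mono_zero, one_mul, HahnSeries.coeff_add, hF0 θ hθr]
        linarith
      · obtain ⟨n, hn, hy⟩ := hy
        refine ⟨n + 1, by lia, fun i hi => ?_⟩
        simp only [mono_zero, one_mul, HahnSeries.coeff_add, hy i hi, hθr i hi, hcC, coeff_one]
        split_ifs <;> simp
    refine (add_le_add_right (h P) _).trans (μ.add_le ?_ hFP fun y hy => (hT y hy).2)
    rw [Set.disjoint_left]
    intro y hy hy'
    have := (hT y hy').1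
    rw [hF0 y hy] at this
    norm_num at this
  -- Translation by `-θ` maps both `N` and `X ^ s * ℚ⟦X⟧` into `N`.
  have hN : z ^ j * (μ N + μ (cball 0 s)) ≤ μ N := by
    have hd : Disjoint N (cball 0 s) := by
      rw [Set.disjoint_left]
      intro y hy hy'
      have := hN0 y hy
      rw [hD0 y hy'] at this
      norm_num at this
    rw [← μ.union' _ _ hd]
    refine (h' _).trans (μ.mono ?_)
    rintro _ ⟨y, hy | hy, rfl⟩
    · obtain ⟨n, hn, hy⟩ := hy
      refine ⟨n + 1, by lia, fun i hi => ?_⟩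
      simp only [mono_zero, one_mul, HahnSeries.coeff_add, hy i hi, HahnSeries.coeff_neg,
        hθs i hi, hcC, coeff_one]
      split_ifs <;> simp; ring
    · refine ⟨1, le_rfl, fun i hi => ?_⟩
      simp only [mono_zero, one_mul, HahnSeries.coeff_add, hy i hi, HahnSeries.coeff_neg,
        hθs i hi, hcC, coeff_one]
      simp
  have hPN : μ (P ∪ N) = μ P + μ N := by
    refine μ.union' _ _ ?_
    rw [Set.disjoint_left]
    intro y hy hy'
    linarith [hP0 y hy, hN0 y hy']
  have htot : μ (P ∪ N) + μ (cball 0 s) ≤ μ (cball 0 0) := by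
    refine μ.add_le ?_ (Set.union_subset hPB hNB) (cball_anti 0 hs.le)
    rw [Set.disjoint_left]
    rintro y (hy | hy) hy'
    · linarith [hP0 y hy, hD0 y hy']
    · linarith [hN0 y hy, hD0 y hy']
  -- With `c = z ^ j`, `F = 1 + X ^ r * ℚ⟦X⟧` and `D = X ^ s * ℚ⟦X⟧`, the estimates read `μ F ≤ (1 -
  -- c) * μ P` and `c * μ D ≤ (1 - c) * μ N`; the disjoint sets `P`, `N`, `D` lie in `ℚ⟦X⟧`.
  have hz' : z ^ j ≤ 1 := pow_le_one₀ hz hz1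
  nlinarith [μ.nonneg P]

lemma cball_one_add_cball_zero_le {r s : ℤ} (hr : 0 < r) (hs : 0 < s) :
    μ (cball 1 r) + μ (cball 0 s) ≤ μ (cball 0 0) := by
  refine μ.add_le ?_ ((cball_anti 1 hr.le).trans_eq cball_one_zero) (cball_anti 0 hs.le)
  rw [Set.disjoint_left]
  intro y hy hy'
  have h1 := hy 0 hr
  have h2 := hy' 0 hs
  rw [h1] at h2
  simp at h2

lemma eq_zero_of_mul_nonpos {β : ℝ} (hz2 : 1 < z ^ 2 + 2 * z) (hβ : 0 ≤ β)
    (h : (z ^ 2 + 2 * z - 1) * β ≤ 0) : β = 0 :=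
  le_antisymm (by_contra fun h' => absurd h (mul_pos (by linarith) (not_le.1 h')).not_ge) hβ

/-- Here `β`, `φ`, `δ`, `x` stand for the measures of `ℚ⟦X⟧`, `1 + X ^ r * ℚ⟦X⟧`, `X ^ s * ℚ⟦X⟧` and
`X ^ k * ℚ⟦X⟧`; `hφ` adds up four disjoint pieces of the second set. -/
lemma eq_zero_of_shells {β φ δ x : ℝ} (hz : 0 < z) (hz1 : z < 1 / 2) (hz2 : 1 < z ^ 2 + 2 * z)
    (hβ : 0 ≤ β) (hx : z * β ≤ x) (hD : x ≤ δ) (hFD : φ + δ ≤ β)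
    (hφ : z * β + z ^ 2 * (β - x) + z ^ 3 * (β - δ) + z ^ 3 * (β - φ) ≤ φ) : β = 0 := by
  have hz2' : 0 < z ^ 2 := by positivity
  have hz3' : 0 < z ^ 3 := by positivity
  have e0 : z ^ 2 * (β - δ) ≤ z ^ 2 * (β - x) := by gcongr
  have e1 : (1 + z ^ 3) * φ ≤ (1 + z ^ 3) * (β - δ) :=
    mul_le_mul_of_nonneg_left (by linarith) (by positivity)
  have e2 : (1 - z ^ 2) * (β - δ) ≤ (1 - z ^ 2) * ((1 - z) * β) :=
    mul_le_mul_of_nonneg_left (by linarith) (by nlinarith)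
  exact eq_zero_of_mul_nonpos hz2 hβ (by linarith)

lemma eq_zero_of_overlap {β φ δ : ℝ} (hz : 0 < z) (hz1 : z < 1 / 2) (hz2 : 1 < z ^ 2 + 2 * z)
    (hβ : 0 ≤ β) (hT : φ + δ ≤ (1 - z ^ 4) * β) (hδ : (z + z ^ 3) * β ≤ δ + z ^ 3 * φ)
    (hφ : (z + z ^ 2 + z ^ 3) * β ≤ (1 + z ^ 3) * φ + z ^ 2 * δ) : β = 0 := by
  have p2 : z ^ 2 < 1 / 4 := by nlinarith
  have p3 : 0 < z ^ 3 := by positivity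
  have p3' : z ^ 3 < 1 / 8 := by nlinarith
  have p5 : z ^ 5 ≤ z ^ 3 := pow_le_pow_of_le_one hz.le (by linarith) (by norm_num)
  -- The multipliers of `hφ` and `hδ` give `φ` and `δ` the common coefficient `1 + z ^ 3 - z ^ 5`,
  -- so that `hT` eliminates both.
  have e1 := mul_le_mul_of_nonneg_left hφ (show 0 ≤ 1 - z ^ 3 by linarith)
  have e2 := mul_le_mul_of_nonneg_left hδ (show 0 ≤ 1 + z ^ 3 - z ^ 2 by linarith)
  have e3 := mul_le_mul_of_nonneg_left hT (show 0 ≤ 1 + z ^ 3 - z ^ 5 by linarith)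
  have p4 : 0 ≤ z ^ 4 * (1 - z) * β :=
    mul_nonneg (mul_nonneg (by positivity) (by linarith)) hβ
  have p7 : 0 ≤ z ^ 7 * (1 - z ^ 2) * β :=
    mul_nonneg (mul_nonneg (by positivity) (by linarith)) hβ
  exact eq_zero_of_mul_nonpos hz2 hβ (by linarith)

/-- A finite measure on Laurent series that is almost invariant, up to a factor `z > √2 - 1`, under
`y ↦ y + 1` and `y ↦ X ^ m * y` vanishes on power series. -/
theorem measure_eq_zero_of_translation (hz : 0 < z) (hz1 : z < 1 / 2) (hz2 : 1 < z ^ 2 + 2 * z)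
    {m : ℤ} (hm : 0 < m) (hU : Cost μ z 0 1 1) (hU' : Cost μ z 0 (-1) 1) (hV : Cost μ z m 0 1) :
    μ (cball 0 0) = 0 := by
  have h1 := cball_add_cball_le hm hm (θ := 1) (fun _ _ => rfl) (fun _ _ => rfl) hU hU' hz.le
    (by linarith)
  have h2 := hV.cball_le (i := 0) (c := 0) (c' := 0) (by simp)
  have h3 := (hU.comp hz.le hV).cball_le (i := 0) (c := 0) (c' := 1) (by simp)
  simp only [zero_add, pow_one, one_add_one_eq_two] at h1 h2 h3
  exact eq_zero_of_mul_nonpos hz2 (μ.nonneg _) (by linarith)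

/-- A finite measure on Laurent series that is almost invariant, up to a factor `z > √2 - 1`, under
`y ↦ X ^ k * y` and `y ↦ X ^ m * y + 1` and their inverses vanishes on power series. -/
theorem measure_eq_zero_of_dilations (hz : 0 < z) (hz1 : z < 1 / 2) (hz2 : 1 < z ^ 2 + 2 * z)
    {k m : ℤ} (hk : 0 < k) (hkm : k ≤ m) (hU : Cost μ z k 0 1) (hU' : Cost μ z (-k) 0 1)
    (hV : Cost μ z m 1 1) (hV' : Cost μ z (-m) (-mono (-m)) 1) :
    μ (cball 0 0) = 0 := by
  have hz0 := hz.le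
  set β := μ (cball 0 0) with hβ
  have hβ0 : 0 ≤ β := μ.nonneg _
  have hβ1 : μ (cball 1 0) = β := by rw [cball_one_zero]
  have hf : ∀ {i j : ℤ}, i ≤ j → μ (cball 1 j) ≤ μ (cball 1 i) := fun h => μ.mono (cball_anti 1 h)
  have hg : ∀ {i j : ℤ}, i ≤ j → μ (cball 0 j) ≤ μ (cball 0 i) := fun h => μ.mono (cball_anti 0 h)
  have hUB : z * β ≤ μ (cball 0 k) := by
    simpa using hU.cball_le (i := 0) (c := 0) (c' := 0) (by simp)
  have hVB : z * β ≤ μ (cball 1 m) := by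
    simpa using hV.cball_le (i := 0) (c := 0) (c' := 1) (by simp)
  -- Write `U` for `y ↦ X ^ k * y` and `V` for `y ↦ X ^ m * y + 1`. The words used are `V U⁻ⁱ`, `V U
  -- V⁻¹` and `Uⁱ V⁻¹`; the exponent of `z` is the word length.
  have hVU1 : Cost μ z (m - k) 1 2 := by simpa [sub_eq_add_neg] using hV.comp hz0 hU'
  have hVU2 : Cost μ z (m - 2 * k) 1 3 := by
    have := hVU1.comp hz0 hU'
    rw [show m - k + -k = m - 2 * k by ring] at this
    simpa using this
  have hVU3 : Cost μ z (m - 3 * k) 1 4 := by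
    have := hVU2.comp hz0 hU'
    rw [show m - 2 * k + -k = m - 3 * k by ring] at this
    simpa using this
  have hVUV : Cost μ z k (1 - mono k) 3 := by
    have := (hV.comp hz0 hU).comp hz0 hV'
    rw [show m + k + -m = k by ring] at this
    simpa [mono_mul_mono, add_comm, sub_eq_add_neg] using this
  have hUV' : Cost μ z (k - m) (- mono (k - m)) 2 := by
    simpa [sub_eq_add_neg, mono_mul_mono] using hU.comp hz0 hV'
  have hUUV' : Cost μ z (2 * k - m) (- mono (2 * k - m)) 3 := by
    have := hU.comp hz0 hUV'
    rw [show k + (k - m) = 2 * k - m by ring] at this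
    simpa [mono_mul_mono, show k + (k - m) = 2 * k - m by ring] using this
  have hUUUV' : Cost μ z (3 * k - m) (- mono (3 * k - m)) 4 := by
    have := hU.comp hz0 hUUV'
    rw [show k + (2 * k - m) = 3 * k - m by ring] at this
    simpa [mono_mul_mono, show k + (2 * k - m) = 3 * k - m by ring] using this
  have hshell1 : z ^ 2 * (β - μ (cball 0 k)) ≤ μ (cball 1 (m - k)) - μ (cball 1 m) := by
    have := hVU1.cball_diff_le (i := 0) (l := k) (c := 0) (c' := 1) (by simp) hk.le
    simpa using this
  have hshell2 : ∀ s : ℤ, 0 ≤ s → z ^ 3 * (β - μ (cball 0 s)) ≤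
      μ (cball 1 (m - 2 * k)) - μ (cball 1 (s + (m - 2 * k))) := fun s hs => by
    have := hVU2.cball_diff_le (i := 0) (l := s) (c := 0) (c' := 1) (by simp) hs
    simpa using this
  have hshell3 : ∀ r : ℤ, 0 ≤ r → z ^ 3 * (β - μ (cball 1 r)) ≤
      μ (cball 1 k) - μ (cball 1 (r + k)) := fun r hr => by
    have := hVUV.cball_diff_le (i := 0) (l := r) (c := 1) (c' := 1) (by simp) hr
    simpa [hβ1] using this
  -- the case of four shells in `1 + X ^ r * ℚ⟦X⟧`
  have key : ∀ r s : ℤ, 0 < r → r ≤ k → r ≤ m - 2 * k → 0 < s → s ≤ k →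
      (r + k ≤ m - 2 * k ∨ (s + (m - 2 * k) ≤ k ∧ r + k ≤ m - k)) → β = 0 := by
    intro r s hr hrk hrm hs hsk h
    have h2 := hshell2 s hs.le
    have h3 := hshell3 r hr.le
    have hFD := cball_one_add_cball_zero_le (μ := μ) hr hs
    have hD := hg hsk
    rw [← hβ] at hFD
    have hφ : z * β + z ^ 2 * (β - μ (cball 0 k)) + z ^ 3 * (β - μ (cball 0 s)) +
        z ^ 3 * (β - μ (cball 1 r)) ≤ μ (cball 1 r) := by
      -- The pieces are the ball `1 + X ^ m * ℚ⟦X⟧` and shells around `1` for the degree ranges `[m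
      -- - k, m)`, `[m - 2k, m - 2k + s)` and `[k, k + r)`. The alternatives are the two orders of
      -- the last two ranges.
      rcases h with h | ⟨h, h'⟩
      · linarith [hf h, hf hrk, hf (show m - k ≥ s + (m - 2 * k) by lia)]
      · linarith [hf h, hf h', hf hrm]
    exact eq_zero_of_shells hz hz1 hz2 hβ0 hUB hD hFD hφ
  by_cases h3k : 3 * k < m
  · exact key (min k (m - 3 * k)) k (by lia) (by lia) (by lia) hk le_rfl (by lia)
  rcases eq_or_ne m (3 * k) with h | h3
  -- For `m = 3k` the word `V U⁻³` is the translation by `1`; likewise `V U⁻²` for `m = 2k` and `V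
  -- U⁻¹` for `m = k`.
  · have hT := cball_add_cball_le hk hk (θ := 1) (fun _ _ => rfl) (fun _ _ => rfl)
      (by simpa [h] using hVU3) (by simpa [h, mono_zero] using hUUUV') hz0 (by linarith)
    have h2 := hshell2 k hk.le
    rw [show m - 2 * k = k by lia, show k + k = m - k by lia] at h2
    have hz2' : 0 < z ^ 2 := by positivity
    have hz3' : z ^ 3 < 1 / 2 := by nlinarith
    have : (z ^ 2 + z ^ 3) * (μ (cball 0 k) - z * β) ≤ 1 * (μ (cball 0 k) - z * β) :=
      mul_le_mul_of_nonneg_right (by nlinarith) (by linarith)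
    exact eq_zero_of_mul_nonpos hz2 hβ0 (by linarith)
  by_cases h2k : 2 * k < m
  -- With these values the three shells occupy the adjacent ranges `[m - 2k, k)`, `[k, m - k)`, `[m
  -- - k, m)`.
  · exact key (m - 2 * k) (3 * k - m) (by lia) (by lia) le_rfl (by lia) (by lia) (by lia)
  rcases eq_or_ne m (2 * k) with h | h2
  · have hT := cball_add_cball_le hk hk (θ := 1) (fun _ _ => rfl) (fun _ _ => rfl)
      (by simpa [h] using hVU2) (by simpa [h, mono_zero] using hUUV') hz0 (by linarith)
    rw [show m - k = k by lia] at hshell1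
    have : z ^ 2 * (μ (cball 0 k) - z * β) ≤ 1 * (μ (cball 0 k) - z * β) :=
      mul_le_mul_of_nonneg_right (by nlinarith) (by linarith)
    exact eq_zero_of_mul_nonpos hz2 hβ0 (by linarith)
  rcases eq_or_ne m k with h | h1
  · have hT := cball_add_cball_le hk hk (θ := 1) (fun _ _ => rfl) (fun _ _ => rfl)
      (by simpa [h] using hVU1) (by simpa [h, mono_zero] using hUV') hz0 (by linarith)
    rw [h] at hVB
    exact eq_zero_of_mul_nonpos hz2 hβ0 (by linarith)
  -- the case `k < m < 2 * k`
  have hτ : Cost μ z 0 (1 - mono k) 4 := by simpa using hVUV.comp hz0 hU'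
  have hτ' : Cost μ z 0 (-(1 - mono k)) 4 := by
    have := (hU.comp hz0 hV).comp hz0 (hU'.comp hz0 hV')
    simpa [mono_mul_mono, mono_zero, show k + m + (-k + -m) = 0 by ring, sub_eq_add_neg,
      add_comm, add_left_comm] using this
  have hθ : ∀ i ≤ k, (1 - mono k : LaurentSeries ℚ) ∈ cball 1 i := fun i hi j hj => by
    simp [coeff_mono, (hj.trans_le hi).ne]
  have hT := cball_add_cball_le (r := m - k) (s := 2 * k - m) (by lia) (by lia)
    (hθ _ (by lia)) (hθ _ (by lia)) hτ hτ' hz0 (by linarith)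
  have hδ : z ^ 3 * (β - μ (cball 1 (m - k))) ≤ μ (cball 0 (2 * k - m)) - μ (cball 0 k) := by
    have := hUUV'.cball_diff_le (i := 0) (l := m - k) (c := 1) (c' := 0) (by simp) (by lia)
    rwa [zero_add, show m - k + (2 * k - m) = k by ring, hβ1] at this
  have hφ1 : z ^ 2 * (β - μ (cball 0 (2 * k - m))) ≤ μ (cball 1 (m - k)) - μ (cball 1 k) := by
    have := hVU1.cball_diff_le (i := 0) (l := 2 * k - m) (c := 0) (c' := 1) (by simp) (by lia)
    rwa [zero_add, show 2 * k - m + (m - k) = k by ring] at this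
  have hφ2 := hshell3 (m - k) (by lia)
  rw [show m - k + k = m by ring] at hφ2
  rw [← hβ] at hT
  exact eq_zero_of_overlap hz hz1 hz2 hβ0 hT (by linarith) (by linarith)

end LaurentSeries

/-! ### The lower bound for all generating sets. -/

/-- The image under `π` of the measure with the weights `w`. -/
noncomputable def FinAddMeasure.ofWeight {G α : Type*} (π : G → α) {w : G → ℝ} (hw : ∀ g, 0 ≤ w g)
    (hs : Summable w) : FinAddMeasure α where
  toFun s := ∑' g, (π ⁻¹' s).indicator w g
  nonneg' s := tsum_nonneg fun g => Set.indicator_nonneg (fun g _ => hw g) g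
  union' s t h := by
    rw [← (hs.indicator _).tsum_add (hs.indicator _), Set.preimage_union,
      Set.indicator_union_of_disjoint (h.preimage π)]

lemma FinAddMeasure.le_ofWeight {G α : Type*} (π : G → α) {w : G → ℝ} (hw : ∀ g, 0 ≤ w g)
    (hs : Summable w) {g : G} {s : Set α} (hg : π g ∈ s) :
    w g ≤ FinAddMeasure.ofWeight π hw hs s := by
  have h := (hs.indicator (π ⁻¹' s)).le_tsum g fun i _ => Set.indicator_nonneg (fun g _ => hw g) i
  rwa [Set.indicator_of_mem (show g ∈ π ⁻¹' s from hg)] at h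

namespace ZWrZ

open LaurentSeries

/-- The coordinates of `g` as the coefficients of a Laurent series. -/
noncomputable def laurent (g : ZWrZ) : LaurentSeries ℚ :=
  HahnSeries.ofFinsupp (Finsupp.ofSupportFinite (fun i => (conf g i : ℚ))
    ((finite_support_conf g).subset fun i hi h => hi (by simp [h])))

@[simp] lemma coeff_laurent (g : ZWrZ) (i : ℤ) : (laurent g).coeff i = conf g i := rfl

lemma ext_laurent {g h : ZWrZ} (h1 : laurent g = laurent h) (h2 : pos g = pos h) : g = h :=
  ext_conf (fun i => by simpa using congrArg (fun y => y.coeff i) h1) h2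

/-- The action of `ℤ ≀ ℤ` on Laurent series by affine maps. -/
noncomputable def act (g : ZWrZ) (y : LaurentSeries ℚ) : LaurentSeries ℚ :=
  mono (pos g) * y + laurent g

lemma laurent_mul (g h : ZWrZ) : laurent (g * h) = act g (laurent h) := by
  ext i
  simp [act, coeff_mono_mul, conf_mul, add_comm]

lemma act_mul (g h : ZWrZ) (y : LaurentSeries ℚ) : act (g * h) y = act g (act h y) := by
  rw [act, laurent_mul, pos_mul, ← mono_mul_mono, act, act, act]
  ring

lemma act_one (y : LaurentSeries ℚ) : act 1 y = y := by
  have : laurent 1 = 0 := by ext i; simp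
  simp [act, this, mono_zero]

lemma exists_act_eq_self {g : ZWrZ} (hg : pos g ≠ 0) : ∃ p, act g p = p := by
  have h : 1 - mono (pos g) ≠ 0 := fun h => by
    have := congrArg (fun y => y.coeff 0) h
    simp [coeff_mono, hg.symm] at this
  refine ⟨laurent g / (1 - mono (pos g)), ?_⟩
  rw [act]
  field_simp
  ring

variable {S : Set ZWrZ} {z : ℝ}

/-- Since `ℓ(s * g) ≤ ℓ(g) + 1` and `z < 1`, the weight of `s * g` is at least `z` times that of
`g`. -/
lemma cost_ofWeight (π : ZWrZ → LaurentSeries ℚ) (hS : Subgroup.closure S = ⊤) (hz : 0 < z)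
    (hz1 : z < 1)
    (hs : Summable fun g => z ^ wordLength S g) {s : ZWrZ} (hsS : s ∈ S ∨ s⁻¹ ∈ S) {n : ℤ}
    {b : LaurentSeries ℚ} (h : ∀ g, π (s * g) = mono n * π g + b) :
    Cost (FinAddMeasure.ofWeight π (fun _ => by positivity) hs) z n b 1 := by
  intro Y
  rw [pow_one]
  change z * ∑' g, _ ≤ ∑' g, _
  rw [← tsum_mul_left, ← (Equiv.mulLeft s).tsum_eq
    (Set.indicator (π ⁻¹' ((fun y => mono n * y + b) '' Y)) fun g => z ^ wordLength S g)]
  refine Summable.tsum_le_tsum (fun g => ?_) ((hs.indicator _).mul_left z)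
    ((Equiv.mulLeft s).summable_iff.2 (hs.indicator _))
  by_cases hg : π g ∈ Y
  · have hg' : s * g ∈ π ⁻¹' ((fun y => mono n * y + b) '' Y) := ⟨π g, hg, (h g).symm⟩
    rw [Equiv.coe_mulLeft, Set.indicator_of_mem hg', Set.indicator_of_mem (by exact hg),
      ← pow_succ']
    exact pow_le_pow_of_le_one hz.le hz1.le (wordLength_mul_le_add_one hS hsS g)
  · rw [Set.indicator_of_notMem (by exact hg), mul_zero]
    exact Set.indicator_nonneg (fun _ _ => by positivity) _

lemma affine_inv {π : ZWrZ → LaurentSeries ℚ} {s : ZWrZ} {n : ℤ} {b : LaurentSeries ℚ}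
    (h : ∀ g, π (s * g) = mono n * π g + b) (g : ZWrZ) :
    π (s⁻¹ * g) = mono (-n) * π g + -(mono (-n) * b) := by
  have := h (s⁻¹ * g)
  rw [mul_inv_cancel_left] at this
  rw [this, mul_add, ← mul_assoc, mono_mul_mono, neg_add_cancel, mono_zero]
  ring

theorem not_summable_of_not_commute (hS : Subgroup.closure S = ⊤) (hz : 0 < z) (hz1 : z < 1 / 2)
    (hz2 : 1 < z ^ 2 + 2 * z) {u v : ZWrZ} (hu : u ∈ S ∨ u⁻¹ ∈ S) (hv : v ∈ S ∨ v⁻¹ ∈ S)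
    (huv : ¬ Commute u v) (hu0 : 0 ≤ pos u) (hle : pos u ≤ pos v) :
    ¬ Summable fun g => z ^ wordLength S g := by
  intro hs
  have hz1' : z < 1 := by linarith
  have hu' : u⁻¹ ∈ S ∨ u⁻¹⁻¹ ∈ S := by rwa [inv_inv, or_comm]
  have hv' : v⁻¹ ∈ S ∨ v⁻¹⁻¹ ∈ S := by rwa [inv_inv, or_comm]
  -- it suffices to find a map `π` for which the measure of the power series vanishes
  have hpos : ∀ π : ZWrZ → LaurentSeries ℚ, π 1 = 0 →
      FinAddMeasure.ofWeight π (fun _ => by positivity) hs (cball 0 0) ≠ 0 := by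
    intro π hπ h0
    have := FinAddMeasure.le_ofWeight π (w := fun g => z ^ wordLength S g)
      (fun _ => by positivity) hs (g := 1) (s := cball 0 0) (by simp [hπ, cball])
    rw [h0] at this
    exact absurd (pow_pos hz _) this.not_gt
  rcases hu0.eq_or_lt with hk | hk
  · have hm : pos v ≠ 0 := fun hm => huv <| by
      refine ext_laurent ?_ (by simp [add_comm])
      rw [laurent_mul, laurent_mul, act, act, hm, ← hk, mono_zero]
      ring
    have hf : laurent u ≠ 0 := fun hf => huv <| by
      have : u = 1 := ext_laurent (by rw [hf]; ext i; simp) hk.symm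
      rw [this]
      exact Commute.one_left v
    obtain ⟨p, hp⟩ := exists_act_eq_self hm
    -- Here `u` is a translation. The coordinate on the series is changed so that the fixed point
    -- `p` of `v` becomes `0` and `u` becomes `y ↦ y + 1`.
    let π : ZWrZ → LaurentSeries ℚ := fun g => (act g p - p) / laurent u
    have hπu : ∀ g, π (u * g) = mono 0 * π g + 1 := fun g => by
      simp only [π]
      rw [act_mul, act, ← hk, mono_zero]
      field_simp
      ring
    have hπv : ∀ g, π (v * g) = mono (pos v) * π g + 0 := fun g => by
      simp only [π]
      rw [act_mul, act, ← sub_eq_of_eq_add' (show p = _ + _ from hp.symm)]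
      field_simp
      ring
    refine hpos π (by simp [π, act_one]) (measure_eq_zero_of_translation hz hz1 hz2
      (lt_of_le_of_ne (hu0.trans hle) hm.symm) (cost_ofWeight π hS hz hz1' hs hu hπu) ?_
      (cost_ofWeight π hS hz hz1' hs hv hπv))
    simpa [mono_zero] using cost_ofWeight π hS hz hz1' hs hu' (affine_inv hπu)
  · obtain ⟨p, hp⟩ := exists_act_eq_self hk.ne'
    have hf : act v p - p ≠ 0 := fun hf => huv <| by
      have hvp := sub_eq_zero.1 hf
      refine ext_laurent ?_ (by simp [add_comm])
      have h : act (u * v) p = act (v * u) p := by rw [act_mul, act_mul, hvp, hp, hvp]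
      rw [act, act, pos_mul, pos_mul, add_comm (pos v)] at h
      exact add_left_cancel h
    -- The fixed point `p` of `u` becomes `0` and its image under `v` becomes `1`; they differ
    -- because `u` and `v` do not commute.
    let π : ZWrZ → LaurentSeries ℚ := fun g => (act g p - p) / (act v p - p)
    have hπu : ∀ g, π (u * g) = mono (pos u) * π g + 0 := fun g => by
      simp only [π]
      rw [act_mul, act, ← sub_eq_of_eq_add' (show p = _ + _ from hp.symm)]
      field_simp
      ring
    have hπv : ∀ g, π (v * g) = mono (pos v) * π g + 1 := fun g => by
      simp only [π]
      rw [← mul_div_assoc, div_add_one hf, act_mul, act, act.eq_1 v p]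
      ring
    refine hpos π (by simp [π, act_one]) (measure_eq_zero_of_dilations hz hz1 hz2
      hk hle (cost_ofWeight π hS hz hz1' hs hu hπu) ?_
      (cost_ofWeight π hS hz hz1' hs hv hπv) ?_)
    · simpa using cost_ofWeight π hS hz hz1' hs hu' (affine_inv hπu)
    · simpa using cost_ofWeight π hS hz hz1' hs hv' (affine_inv hπv)

lemma exists_not_commute (hS : Subgroup.closure S = ⊤) :
    ∃ u v : ZWrZ, (u ∈ S ∨ u⁻¹ ∈ S) ∧ (v ∈ S ∨ v⁻¹ ∈ S) ∧ ¬ Commute u v ∧ 0 ≤ pos u ∧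
      pos u ≤ pos v := by
  have h : ∃ x ∈ S, ∃ y ∈ S, ¬ Commute x y := by
    by_contra! h
    have hat : a * t = t * a := by
      have := Subgroup.isMulCommutative_closure h
      rw [hS] at this
      exact congrArg Subtype.val
        (mul_comm' (⟨a, trivial⟩ : (⊤ : Subgroup ZWrZ)) ⟨t, trivial⟩)
    have := congrArg (fun g => conf g 0) hat
    simp [conf_mul, conf_a] at this
  have hsign : ∀ x ∈ S, ∃ u, (u ∈ S ∨ u⁻¹ ∈ S) ∧ 0 ≤ pos u ∧ ∀ y, Commute u y ↔ Commute x y := by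
    intro x hx
    rcases le_total 0 (pos x) with h | h
    · exact ⟨x, Or.inl hx, h, fun y => Iff.rfl⟩
    · exact ⟨x⁻¹, Or.inr (by rwa [inv_inv]), by simpa using h, fun y => Commute.inv_left_iff⟩
  obtain ⟨x, hx, y, hy, hxy⟩ := h
  obtain ⟨u, hu, hu0, huc⟩ := hsign x hx
  obtain ⟨v, hv, hv0, hvc⟩ := hsign y hy
  have huv : ¬ Commute u v := by
    rwa [huc, Commute.symm_iff, hvc, Commute.symm_iff]
  rcases le_total (pos u) (pos v) with h | h
  · exact ⟨u, v, hu, hv, huv, hu0, h⟩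
  · exact ⟨v, u, hv, hu, fun h => huv h.symm, hv0, h⟩

theorem le_growthRate (hf : S.Finite) (hS : Subgroup.closure S = ⊤) : 1 + √2 ≤ growthRate S := by
  by_contra! hlt
  obtain ⟨b1, b2, b3⟩ := sqrt_two_bounds
  -- The lower bound `2` on `w` ensures `w⁻¹ < 1 / 2`.
  obtain ⟨w, hw, hw'⟩ := exists_between (max_lt hlt (show (2 : ℝ) < 1 + √2 by linarith))
  rw [max_lt_iff] at hw
  have hw0 : 0 < w := by linarith
  obtain ⟨u, v, hu, hv, huv, hu0, hle⟩ := exists_not_commute hS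
  refine not_summable_of_not_commute (z := w⁻¹) hS (inv_pos.2 hw0) ?_ ?_ hu hv huv hu0 hle
    (summable_pow_wordLength hf hS (inv_pos.2 hw0) (by rw [inv_inv]; exact hw.1))
  · rw [one_div]
    exact inv_strictAnti₀ two_pos hw.2
  · have : w⁻¹ ^ 2 + 2 * w⁻¹ = (1 + 2 * w) / w ^ 2 := by field_simp
    rw [this, one_lt_div (by positivity)]
    nlinarith

end ZWrZ

theorem corollary3 :
    -- `ℤ ≀ ℤ = ⟨a, t ∣ [t ^ k * a * t ^ (-k), a] = 1 (k = 1, 2, …)⟩`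
    (∃ e : PresentedGroup ZWrZ.relators ≃* ZWrZ,
      e (PresentedGroup.of 0) = ZWrZ.a ∧ e (PresentedGroup.of 1) = ZWrZ.t) ∧
    -- the limit defining the growth rate exists for every finite generating set
    (∀ S : Set ZWrZ, S.Finite → Subgroup.closure S = ⊤ →
      Tendsto (fun n : ℕ => (growthFunction S n : ℝ) ^ (1 / (n : ℝ))) atTop
        (𝓝 (growthRate S))) ∧
    -- the minimal growth rate is realized on the generating set `{a, t}` and is `1 + √2`
    Subgroup.closure ({ZWrZ.a, ZWrZ.t} : Set ZWrZ) = ⊤ ∧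
    minimalGrowthRate ZWrZ = growthRate ({ZWrZ.a, ZWrZ.t} : Set ZWrZ) ∧
    growthRate ({ZWrZ.a, ZWrZ.t} : Set ZWrZ) = 1 + √2 := by
  have hrate : growthRate ({ZWrZ.a, ZWrZ.t} : Set ZWrZ) = 1 + √2 :=
    le_antisymm ZWrZ.growthRate_a_t_le (ZWrZ.le_growthRate (by simp) ZWrZ.closure_a_t)
  refine ⟨⟨MulEquiv.ofBijective _ ZWrZ.bijective_ofPresented, ZWrZ.ofPresented_zero,
    ZWrZ.ofPresented_one⟩, fun S hf hS => tendsto_growthRate hf hS, ZWrZ.closure_a_t, ?_, hrate⟩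
  refine IsLeast.csInf_eq ⟨⟨_, by simp, ZWrZ.closure_a_t, rfl⟩, ?_⟩
  rintro _ ⟨S, hf, hS, rfl⟩
  rw [hrate]
  exact ZWrZ.le_growthRate hf hS
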